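/- Let $\alpha>1$, $\bar\theta\in(0,\pi)$, $k>0$, $x_2(0)<0$, $\dot x_1(0)>0$, $\dot x_2(0)>0$. Let $K=\{x\in\mathbb R^2: x_1\le 0,\ x_1\cos\bar\theta+x_2\sin\bar\theta\le 0\}$, let $P_K$ be the orthogonal projection onto $K$, and let $G(u,v)=\bigl(v\cdot(u-P_Ku)\bigr)(u-P_Ku)/|u-P_Ku|^2$ if $u\notin K$, $G(u,v)=0$ if $u\in K$. Consider the penalized problem $$\ddot u+2\alpha\sqrt k\,G(u,\dot u)+k(u-P_Ku)=0,\qquad u(0)=(0,x_2(0)),\quad \dot u(0)=(\dot x_1(0),\dot x_2(0)),$$ where $u$ is $C^1$ and the equation is understood in integrated form. Put $$\Delta=\alpha^2-1,\quad \xi_1=-\alpha+\sqrt\Delta,\quad \xi_2=-\alpha-\sqrt\Delta,\quad t_0=-\frac{x_2(0)}{\dot x_2(0)},$$ $$\eta=e^{\xi_1t_0\sqrt k/2},\quad \varepsilon=e^{(\xi_2-\xi_1)t_0\sqrt k},\quad E=\frac{\dot x_1(0)^2\dot x_2(0)^2}{4\Delta}.$$ Consider the scaled polar equations, for $R>0$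 and $\Theta$ on $[0,\infty)$, $$\ddot R-\frac{E(1-\varepsilon)^2}{R^3}+2\alpha\dot R+R=0,\qquad \dot\Theta=\frac{\sqrt E\,(1-\varepsilon)}{R^2},$$ $$R(0)=\frac{\eta\,\dot x_1(0)(1-\varepsilon)}{2\sqrt\Delta},\qquad \dot R(0)=\frac{\eta\,\dot x_1(0)\,\xi_1(1-\varepsilon\xi_2/\xi_1)}{2\sqrt\Delta},\qquad \Theta(0)=0.$$ Then these equations have a solution $(R,\Theta)$ on all of $[0,\infty)$, and for every such solution there exists a time $\bar\tau\in(0,\infty)$ such that $\Theta(\bar\tau)=\bar\theta$. Moreover, up to this time $(R,\Theta)$ are the scaled polar coordinates of the penalized motion: identifying $\mathbb R^2$ with $\mathbb C$, every solution $u$ of the penalized problem on an interval $[0,T]$ satisfies $$u(t)=\frac{\eta R(\tau)}{\sqrt k}\,e^{i\Theta(\tau)},\qquad t=t_0+\frac{\tau}{\sqrt k},$$ for all $\tau\in[0,\bar\tau]$ with $t_0+\tau/\sqrt k\le T$. -/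

import Mathlib

open Set

noncomputable section

namespace PenaltyCorner

/-- The data of the penalized problem: damping `α`, opening parameter `θbar`, stiffness `k`, and
the initial position `(0, x₂0)` and initial velocity `(v₁, v₂)`.  The plane is identified with `ℂ`. -/
structure ProblemData where
  α : ℝ
  θbar : ℝ
  k : ℝ
  x₂0 : ℝ
  v₁ : ℝ
  v₂ : ℝ

/-- The angular domain `K`. -/
def angularDomain (θbar : ℝ) : Set ℂ :=
  {x | x.re ≤ 0 ∧ x.re * Real.cos θbar + x.im * Real.sin θbar ≤ 0}

/-- A point of `K` nearest to `x`; for a nonempty closed convex set `K` there is exactly one. -/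
def proj (K : Set ℂ) (x : ℂ) : ℂ :=
  Classical.epsilon fun y => y ∈ K ∧ ∀ z ∈ K, ‖x - y‖ ≤ ‖x - z‖

open Classical in
/-- The damping direction `G(u, v)`. -/
def damping (K : Set ℂ) (u v : ℂ) : ℂ :=
  if u ∈ K then 0
  else (inner ℝ v (u - proj K u) / ‖u - proj K u‖ ^ 2) • (u - proj K u)

namespace ProblemData

variable (p : ProblemData)

/-- The acceleration `-2α√k G(u, v) - k (u - P_K u)` of the penalized problem. -/
def acceleration (u v : ℂ) : ℂ :=
  -((2 * p.α * √p.k) • damping (angularDomain p.θbar) u v)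
    - p.k • (u - proj (angularDomain p.θbar) u)

/-- `u` is a solution on `[0, T]`, with velocity `v`, of the penalized problem
`ü + 2α√k G(u, u̇) + k (u - P_K u) = 0`, `u(0) = (0, x₂0)`, `u̇(0) = (v₁, v₂)`.
Since `G` jumps across the boundary of `K` (where the motion starts), the second-order equation is
required in integrated form. -/
structure IsPenalizedMotionOn (T : ℝ) (u v : ℝ → ℂ) : Prop where
  init_pos : u 0 = ⟨0, p.x₂0⟩
  init_vel : v 0 = ⟨p.v₁, p.v₂⟩
  vel_cont : ContinuousOn v (Icc 0 T)
  vel : ∀ t ∈ Icc 0 T, HasDerivWithinAt u (v t) (Icc 0 T) t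
  integrable : ∀ t ∈ Icc 0 T,
    IntervalIntegrable (fun σ => p.acceleration (u σ) (v σ)) MeasureTheory.volume 0 t
  motion : ∀ t ∈ Icc 0 T, v t = v 0 + ∫ σ in (0 : ℝ)..t, p.acceleration (u σ) (v σ)

def Δ : ℝ := p.α ^ 2 - 1

def ξ₁ : ℝ := -p.α + √p.Δ

def ξ₂ : ℝ := -p.α - √p.Δ

/-- The time at which the motion arrives at the half-line `x₂ = 0`. -/
def t₀ : ℝ := -p.x₂0 / p.v₂

def η : ℝ := Real.exp (p.ξ₁ * p.t₀ * √p.k / 2)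

def ε : ℝ := Real.exp ((p.ξ₂ - p.ξ₁) * p.t₀ * √p.k)

def E : ℝ := p.v₁ ^ 2 * p.v₂ ^ 2 / (4 * p.Δ)

/-- `R > 0` and `Θ` solve on `[0, ∞)` the scaled equations of motion in polar coordinates,
with `V` the derivative of `R`. -/
structure IsScaledMotion (R V Θ : ℝ → ℝ) : Prop where
  pos : ∀ τ ∈ Ici (0 : ℝ), 0 < R τ
  init_R : R 0 = p.η * p.v₁ * (1 - p.ε) / (2 * √p.Δ)
  init_V : V 0 = p.η * p.v₁ * p.ξ₁ * (1 - p.ε * p.ξ₂ / p.ξ₁) / (2 * √p.Δ)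
  init_Θ : Θ 0 = 0
  deriv_R : ∀ τ ∈ Ici (0 : ℝ), HasDerivWithinAt R (V τ) (Ici 0) τ
  deriv_V : ∀ τ ∈ Ici (0 : ℝ), HasDerivWithinAt V
    (p.E * (1 - p.ε) ^ 2 / R τ ^ 3 - 2 * p.α * V τ - R τ) (Ici 0) τ
  deriv_Θ : ∀ τ ∈ Ici (0 : ℝ), HasDerivWithinAt Θ (√p.E * (1 - p.ε) / R τ ^ 2) (Ici 0) τ

end ProblemData

end PenaltyCorner

end

/-! Two smooth regimes make up the motion up to angle `θbar`. While the nearest point of `K` lies on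
the first edge, the first coordinate is an overdamped oscillator with rates `√k ξ₁`, `√k ξ₂` and the
second grows uniformly, vanishing at `t₀`. Between the normals at the corner the nearest point is
the corner itself, so both spring and damping are radial: angular momentum is conserved, and scaling
time by `√k` and length by `η / √k` gives the polar equations. Their initial data are the position
and velocity of the edge motion at `t₀`.

The energy `V² / 2 + R² / 2 + c² / (2 R²)` does not increase along polar solutions. It keeps `R`
away from zero and infinity, which gives global existence (`exists_polar_solution`), and it bounds
`Θ' = c / R²` below, so `Θ` increases past `θbar` (`polar_angle_growth`).

An arbitrary penalized motion must then be identified with these two pieces although `G` jumps at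
the boundary of `K`, where the motion starts. `IsPenalizedMotionOn.eqOn_of_field` needs only that
just after each instant of agreement the acceleration is the expected smooth field. Inside a region
this is continuity; at the two entry times `0` and `t₀` it follows from the sign of one velocity
component. -/

namespace PenaltyCorner

open Filter Topology NNReal MeasureTheory

/-! ### Global existence for the polar equations -/

/-- A bounded Lipschitz vector field on a Banach space has forward solutions defined for all
times. -/
theorem exists_forward_solution {E : Type*} [NormedAddCommGroup E] [NormedSpace ℝ E]
    [CompleteSpace E] {f : E → E} {K L : ℝ≥0} (hf : LipschitzWith K f) (hL : ∀ x, ‖f x‖ ≤ L)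
    (x₀ : E) :
    ∃ γ : ℝ → E, γ 0 = x₀ ∧ ∀ t ∈ Ici (0 : ℝ), HasDerivWithinAt γ (f (γ t)) (Ici 0) t := by
  have hex : ∀ N : ℕ, ∃ γ : ℝ → E, γ 0 = x₀ ∧
      ∀ t ∈ Icc (0 : ℝ) N, HasDerivWithinAt γ (f (γ t)) (Icc 0 N) t := by
    intro N
    have hN : (0 : ℝ) ≤ N := N.cast_nonneg
    -- Speed at most `L` cannot leave the ball of radius `L * N` within time `N`, so Picard–Lindelöf
    -- covers the whole interval at once.
    have hPL : IsPicardLindelof (fun _ => f) (⟨0, left_mem_Icc.2 hN⟩ : Icc (0 : ℝ) N) x₀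
        (L * N) 0 L K :=
      { lipschitzOnWith := fun _ _ => hf.lipschitzOnWith
        continuousOn := fun _ _ => continuousOn_const
        norm_le := fun _ _ x _ => hL x
        mul_max_le := by simp }
    exact hPL.exists_eq_forall_mem_Icc_hasDerivWithinAt₀
  choose γ h0 hγ using hex
  have hagree : ∀ {M N : ℕ}, M ≤ N → EqOn (γ M) (γ N) (Icc 0 M) := by
    intro M N hMN
    have hsub : Icc (0 : ℝ) M ⊆ Icc 0 N := Icc_subset_Icc_right (by exact_mod_cast hMN)
    refine ODE_solution_unique (v := fun _ => f) (fun _ => hf)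
      (fun t ht => (hγ M t ht).continuousWithinAt) ?_
      (fun t ht => ((hγ N t (hsub ht)).mono hsub).continuousWithinAt) ?_ (by rw [h0, h0])
    · intro t ht
      exact (hγ M t (Ico_subset_Icc_self ht)).mono_of_mem_nhdsWithin
        (mem_of_superset (Icc_mem_nhdsGE ht.2) (Icc_subset_Icc_left ht.1))
    · intro t ht
      exact ((hγ N t (hsub (Ico_subset_Icc_self ht))).mono hsub).mono_of_mem_nhdsWithin
        (mem_of_superset (Icc_mem_nhdsGE ht.2) (Icc_subset_Icc_left ht.1))
  have heq : ∀ (N : ℕ) (t : ℝ), t ∈ Icc (0 : ℝ) N → γ ⌈t⌉₊ t = γ N t := fun N t ht =>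
    hagree (Nat.ceil_le.2 ht.2) ⟨ht.1, Nat.le_ceil t⟩
  refine ⟨fun t => γ ⌈t⌉₊ t, by simp [h0], fun t ht => ?_⟩
  -- The interval is enlarged by one because `t` may equal its own ceiling, and a neighbourhood to
  -- its right is needed.
  have hlt : t < (⌈t⌉₊ + 1 : ℕ) := by push_cast; linarith [Nat.le_ceil t]
  have hder := hγ (⌈t⌉₊ + 1) t ⟨ht, hlt.le⟩
  have hcongr : HasDerivWithinAt (fun t => γ ⌈t⌉₊ t) (f (γ ⌈t⌉₊ t))
      (Icc 0 ((⌈t⌉₊ + 1 : ℕ) : ℝ)) t := by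
    rw [heq _ t ⟨ht, hlt.le⟩]
    exact hder.congr (fun s hs => heq _ s hs) (heq _ t ⟨ht, hlt.le⟩)
  refine hcongr.mono_of_mem_nhdsWithin ?_
  rw [← Ici_inter_Iic]
  exact inter_mem_nhdsWithin _ (Iic_mem_nhds hlt)

/-- The energy of the equation `R'' = c² / R³ - 2 α R' - R`. -/
noncomputable def energy (c : ℝ) (R V : ℝ) : ℝ := V ^ 2 / 2 + R ^ 2 / 2 + c ^ 2 / (2 * R ^ 2)

/-- The terms `c² / R³` and `-R` are conservative, so only damping contributes: the derivative of
the energy is `-2 α V²`. -/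
theorem antitoneOn_energy {α c : ℝ} (hα : 0 ≤ α) {R V : ℝ → ℝ} {s : Set ℝ} (hs : Convex ℝ s)
    (hR₀ : ∀ t ∈ s, R t ≠ 0) (hR : ∀ t ∈ s, HasDerivWithinAt R (V t) s t)
    (hV : ∀ t ∈ s, HasDerivWithinAt V (c ^ 2 / R t ^ 3 - 2 * α * V t - R t) s t) :
    AntitoneOn (fun t => energy c (R t) (V t)) s := by
  have hder : ∀ t ∈ s, HasDerivWithinAt (fun t => energy c (R t) (V t))
      (-(2 * α * V t ^ 2)) s t := by
    intro t ht
    have h := ((((hV t ht).pow 2).div_const 2).add (((hR t ht).pow 2).div_const 2)).add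
      ((hasDerivWithinAt_const t s (c ^ 2)).div (((hR t ht).pow 2).const_mul 2)
        (by simpa using hR₀ t ht))
    have hne := hR₀ t ht
    refine h.congr_deriv ?_
    simp only [Pi.pow_apply]
    field_simp
    ring
  refine antitoneOn_of_hasDerivWithinAt_nonpos hs (fun t ht => (hder t ht).continuousWithinAt)
    (fun t ht => (hder t (interior_subset ht)).mono interior_subset) ?_
  intro t _
  nlinarith [mul_nonneg hα (sq_nonneg (V t))]

theorem lt_of_energy_lt {c R V m : ℝ} (hR : 0 < R) (hm : 0 < m) (hc : 0 < c)
    (h : energy c R V < c ^ 2 / (2 * m ^ 2)) : m < R := by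
  unfold energy at h
  have h1 : c ^ 2 / (2 * R ^ 2) < c ^ 2 / (2 * m ^ 2) := by
    nlinarith [sq_nonneg V, sq_nonneg R]
  rw [div_lt_div_iff_of_pos_left (by positivity) (by positivity) (by positivity)] at h1
  exact lt_of_pow_lt_pow_left₀ 2 hR.le (by linarith)

theorem abs_lt_of_energy_lt {c R V B : ℝ} (hB : 0 < B) (h : energy c R V < B ^ 2 / 2) :
    |R| < B ∧ |V| < B := by
  unfold energy at h
  have h1 : 0 ≤ c ^ 2 / (2 * R ^ 2) := by positivity
  constructor <;> refine abs_lt_of_sq_lt_sq ?_ hB.le <;> nlinarith [sq_nonneg V, sq_nonneg R]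

/-- The vector field of the polar equations, as a function of `(R, R')`. -/
noncomputable def polarField (α c : ℝ) (q : ℝ × ℝ) : ℝ × ℝ × ℝ :=
  (q.2, c ^ 2 / q.1 ^ 3 - 2 * α * q.2 - q.1, c / q.1 ^ 2)

/-- Global existence for the polar equations: the energy confines the motion to a compact set. -/
theorem exists_polar_solution {α c R₀ V₀ : ℝ} (hα : 0 ≤ α) (hc : 0 < c) (hR₀ : 0 < R₀) :
    ∃ R V Θ : ℝ → ℝ, R 0 = R₀ ∧ V 0 = V₀ ∧ Θ 0 = 0 ∧ ∀ t ∈ Ici (0 : ℝ), 0 < R t ∧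
      HasDerivWithinAt R (V t) (Ici 0) t ∧
      HasDerivWithinAt V (c ^ 2 / R t ^ 3 - 2 * α * V t - R t) (Ici 0) t ∧
      HasDerivWithinAt Θ (c / R t ^ 2) (Ici 0) t := by
  set H₀ := energy c R₀ V₀ with hH₀
  have hH₀pos : 0 < H₀ := by unfold H₀ energy; positivity
  obtain ⟨B, hB, hHB⟩ : ∃ B : ℝ, 0 < B ∧ H₀ < B ^ 2 / 2 :=
    ⟨H₀ + 2, by positivity, by nlinarith⟩
  obtain ⟨m, hm, hHm⟩ : ∃ m : ℝ, 0 < m ∧ H₀ < c ^ 2 / (2 * m ^ 2) := by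
    -- This choice makes `c² / (2 m²) = 2 H₀`.
    refine ⟨c / √(4 * H₀), by positivity, ?_⟩
    rw [div_pow, Real.sq_sqrt (by positivity)]
    field_simp
    norm_num
  have hmR₀ : m < R₀ := lt_of_energy_lt hR₀ hm hc hHm
  have hRB₀ := abs_lt_of_energy_lt hB hHB
  have hmB : m ≤ B := hmR₀.le.trans ((le_abs_self _).trans hRB₀.1.le)
  have hBB : -B ≤ B := by linarith
  set box : Set (ℝ × ℝ) := Icc m B ×ˢ Icc (-B) B with hbox
  have hboxc : IsCompact box := isCompact_Icc.prod isCompact_Icc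
  have hCD : ContDiffOn ℝ 1 (polarField α c) box := by
    intro q hq
    have hq1 : q.1 ≠ 0 := (hm.trans_le hq.1.1).ne'
    refine ContDiffAt.contDiffWithinAt ?_
    unfold polarField
    refine contDiffAt_snd.prodMk (ContDiffAt.prodMk ?_ ?_)
    · have h : ContDiffAt ℝ 1 (fun q : ℝ × ℝ => c ^ 2 / q.1 ^ 3) q :=
        contDiffAt_const.div (contDiffAt_fst.pow 3) (pow_ne_zero 3 hq1)
      exact (h.sub (contDiffAt_const.mul contDiffAt_snd)).sub contDiffAt_fst
    · exact contDiffAt_const.div (contDiffAt_fst.pow 2) (pow_ne_zero 2 hq1)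
  obtain ⟨K, hK⟩ := hCD.exists_lipschitzOnWith one_ne_zero
    ((convex_Icc m B).prod (convex_Icc (-B) B)) hboxc
  obtain ⟨L, hL⟩ := hboxc.exists_bound_of_continuousOn hCD.continuousOn
  -- Clamping `(R, V)` to the box makes the field bounded and globally Lipschitz without changing it
  -- on the box.
  set ρ : ℝ × ℝ × ℝ → ℝ × ℝ := fun x =>
    ((projIcc m B hmB x.1 : ℝ), (projIcc (-B) B hBB x.2.1 : ℝ)) with hρ
  have hρbox : ∀ x, ρ x ∈ box := fun x => ⟨Subtype.prop _, Subtype.prop _⟩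
  have hρL : LipschitzWith (max 1 1) ρ := by
    refine LipschitzWith.prodMk ?_ ?_
    · simpa [Function.comp_def] using (LipschitzWith.subtype_val (Icc m B)).comp
        ((LipschitzWith.projIcc hmB).comp LipschitzWith.prod_fst)
    · simpa [Function.comp_def] using (LipschitzWith.subtype_val (Icc (-B) B)).comp
        ((LipschitzWith.projIcc hBB).comp
          (LipschitzWith.prod_fst.comp LipschitzWith.prod_snd))
  have hFL : LipschitzWith (K * max 1 1) (polarField α c ∘ ρ) := by
    rw [← lipschitzOnWith_univ] at hρL ⊢
    exact hK.comp hρL (fun x _ => hρbox x)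
  obtain ⟨γ, hγ0, hγ⟩ := exists_forward_solution (L := L.toNNReal) hFL
    (fun x => (hL _ (hρbox x)).trans (Real.le_coe_toNNReal L)) (R₀, V₀, 0)
  have hγc : ContinuousOn γ (Ici 0) := fun t ht => (hγ t ht).continuousWithinAt
  set U : Set (ℝ × ℝ × ℝ) := Ioo m B ×ˢ (Ioo (-B) B ×ˢ univ) with hU
  have hUo : IsOpen U := isOpen_Ioo.prod (isOpen_Ioo.prod isOpen_univ)
  have hρU : ∀ x ∈ closure U, ρ x = (x.1, x.2.1) := by
    intro x hx
    rw [hU, closure_prod_eq, closure_prod_eq] at hx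
    have h1 := closure_minimal Ioo_subset_Icc_self isClosed_Icc hx.1
    have h2 := closure_minimal Ioo_subset_Icc_self isClosed_Icc hx.2.1
    simp only [hρ]
    rw [projIcc_of_mem hmB h1, projIcc_of_mem hBB h2]
  have hfield : ∀ t ∈ Ici (0 : ℝ), γ t ∈ closure U → ∀ s ⊆ Ici (0 : ℝ),
      HasDerivWithinAt (fun t => (γ t).1) (γ t).2.1 s t ∧
      HasDerivWithinAt (fun t => (γ t).2.1)
        (c ^ 2 / (γ t).1 ^ 3 - 2 * α * (γ t).2.1 - (γ t).1) s t ∧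
      HasDerivWithinAt (fun t => (γ t).2.2) (c / (γ t).1 ^ 2) s t := by
    intro t ht hcl s hs
    have h := (hγ t ht).mono hs
    rw [Function.comp_apply, hρU _ hcl] at h
    have h' := h.hasFDerivWithinAt
    exact ⟨by simpa [polarField] using h'.fst.hasDerivWithinAt,
      by simpa [polarField] using h'.snd.fst.hasDerivWithinAt,
      by simpa [polarField] using h'.snd.snd.hasDerivWithinAt⟩
  -- First exit time argument: up to and including `t₁` the clamped field is the true one, so the
  -- energy has not increased, and its strict bounds put `γ t₁` back in the open set `U`.
  have hstay : ∀ t ∈ Ici (0 : ℝ), γ t ∈ U := by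
    by_contra! hcon
    set S : Set ℝ := Ici 0 ∩ γ ⁻¹' Uᶜ with hS
    have hSc : IsClosed S := hγc.preimage_isClosed_of_isClosed isClosed_Ici hUo.isClosed_compl
    have hSne : S.Nonempty := hcon
    have hSb : BddBelow S := ⟨0, fun t ht => ht.1⟩
    have hmem := hSc.csInf_mem hSne hSb
    set t₁ := sInf S
    have hbefore : ∀ t ∈ Ico 0 t₁, γ t ∈ U := by
      intro t ht
      by_contra hn
      exact absurd (csInf_le hSb ⟨ht.1, hn⟩) (not_le.2 ht.2)
    have hU0 : γ 0 ∈ U := by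
      rw [hγ0]
      exact ⟨⟨hmR₀, (abs_lt.1 hRB₀.1).2⟩, abs_lt.1 hRB₀.2, trivial⟩
    have ht₁ : 0 < t₁ := lt_of_le_of_ne hmem.1 (fun h => hmem.2 (h ▸ hU0))
    have hcl : ∀ t ∈ Icc 0 t₁, γ t ∈ closure U := by
      intro t ht
      have : MapsTo γ (closure (Ico 0 t₁)) (closure U) := by
        refine MapsTo.closure_of_continuousOn hbefore ?_
        rw [closure_Ico ht₁.ne]
        exact hγc.mono Icc_subset_Ici_self
      rw [closure_Ico ht₁.ne] at this
      exact this ht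
    have hpos : ∀ t ∈ Icc 0 t₁, 0 < (γ t).1 := by
      intro t ht
      have h := hcl t ht
      rw [hU, closure_prod_eq] at h
      exact hm.trans_le (closure_minimal Ioo_subset_Icc_self isClosed_Icc h.1).1
    have hanti := antitoneOn_energy (c := c) hα (convex_Icc 0 t₁) (fun t ht => (hpos t ht).ne')
      (fun t ht => (hfield t ht.1 (hcl t ht) _ Icc_subset_Ici_self).1)
      (fun t ht => (hfield t ht.1 (hcl t ht) _ Icc_subset_Ici_self).2.1)
    have hle := hanti (left_mem_Icc.2 ht₁.le) (right_mem_Icc.2 ht₁.le) ht₁.le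
    simp only [hγ0] at hle
    have h1 := lt_of_energy_lt (hpos t₁ (right_mem_Icc.2 ht₁.le)) hm hc (hle.trans_lt hHm)
    have h2 := abs_lt_of_energy_lt hB (hle.trans_lt hHB)
    exact hmem.2 ⟨⟨h1, (abs_lt.1 h2.1).2⟩, abs_lt.1 h2.2, trivial⟩
  refine ⟨fun t => (γ t).1, fun t => (γ t).2.1, fun t => (γ t).2.2, by simp [hγ0], by simp [hγ0],
    by simp [hγ0], fun t ht => ⟨hm.trans (hstay t ht).1.1, ?_⟩⟩
  exact hfield t ht (subset_closure (hstay t ht)) _ subset_rfl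

/-! ### Growth of the polar angle -/

/-- The polar angle of a solution of the polar equations is strictly increasing and tends to
infinity at least linearly. -/
theorem polar_angle_growth {α c : ℝ} (hα : 0 ≤ α) (hc : 0 < c) {R V Θ : ℝ → ℝ}
    (hpos : ∀ t ∈ Ici (0 : ℝ), 0 < R t)
    (hR : ∀ t ∈ Ici (0 : ℝ), HasDerivWithinAt R (V t) (Ici 0) t)
    (hV : ∀ t ∈ Ici (0 : ℝ),
      HasDerivWithinAt V (c ^ 2 / R t ^ 3 - 2 * α * V t - R t) (Ici 0) t)
    (hΘ : ∀ t ∈ Ici (0 : ℝ), HasDerivWithinAt Θ (c / R t ^ 2) (Ici 0) t) :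
    StrictMonoOn Θ (Ici 0) ∧ ∃ d > 0, ∀ t ∈ Ici (0 : ℝ), Θ 0 + d * t ≤ Θ t := by
  have hΘc : ContinuousOn Θ (Ici 0) := fun t ht => (hΘ t ht).continuousWithinAt
  have hanti := antitoneOn_energy (c := c) hα (convex_Ici 0) (fun t ht => (hpos t ht).ne') hR hV
  constructor
  · refine strictMonoOn_of_hasDerivWithinAt_pos (convex_Ici 0) hΘc
      (fun t ht => (hΘ t (interior_subset ht)).mono interior_subset) ?_
    intro t ht
    have := hpos t (interior_subset ht)
    positivity
  · have h0 := hpos 0 self_mem_Ici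
    set H₀ := energy c (R 0) (V 0) with hH₀
    have hH₀pos : 0 < H₀ := by unfold H₀ energy; positivity
    -- The energy bound gives `R² ≤ 2 H₀`, hence `Θ' ≥ c / (2 H₀)`.
    refine ⟨c / (2 * H₀), by positivity, fun t ht => ?_⟩
    have hmono : MonotoneOn (fun t => Θ t - c / (2 * H₀) * t) (Ici 0) := by
      refine monotoneOn_of_hasDerivWithinAt_nonneg
        (f' := fun t => c / R t ^ 2 - c / (2 * H₀) * 1) (convex_Ici 0)
        (hΘc.sub (by fun_prop)) ?_ ?_
      · intro t ht
        exact ((hΘ t (interior_subset ht)).mono interior_subset).sub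
          ((hasDerivWithinAt_id _ _).const_mul _)
      · intro t ht
        have hp := hpos t (interior_subset ht)
        have hle : energy c (R t) (V t) ≤ H₀ :=
          hanti self_mem_Ici (interior_subset ht) (interior_subset ht)
        have hR2 : R t ^ 2 ≤ 2 * H₀ := by
          unfold energy at hle
          have h1 : 0 ≤ c ^ 2 / (2 * R t ^ 2) := by positivity
          nlinarith [sq_nonneg (V t)]
        have := div_le_div_of_nonneg_left hc.le (by positivity) hR2
        linarith
    have := hmono self_mem_Ici ht ht
    simp only [mul_zero, sub_zero] at this
    linarith

/-! ### Nearest points of the angular domain -/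

/-- The obtuse-angle condition determines the nearest point. -/
theorem proj_eq_of_inner_nonpos {K : Set ℂ} {x y : ℂ} (hy : y ∈ K)
    (h : ∀ z ∈ K, inner ℝ (x - y) (z - y) ≤ 0) : proj K x = y := by
  -- The extra term `‖z - y‖²` yields uniqueness of the minimizer as well as minimality, so the
  -- choice made by `proj` is forced.
  have key : ∀ z ∈ K, ‖x - y‖ ^ 2 + ‖z - y‖ ^ 2 ≤ ‖x - z‖ ^ 2 := by
    intro z hz
    have h1 := norm_sub_sq_real (x - y) (z - y)
    rw [sub_sub_sub_cancel_right] at h1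
    linarith [h z hz]
  have hmin : ∀ z ∈ K, ‖x - y‖ ≤ ‖x - z‖ := fun z hz =>
    le_of_sq_le_sq (by nlinarith [key z hz, sq_nonneg ‖z - y‖]) (norm_nonneg _)
  have hspec : proj K x ∈ K ∧ ∀ z ∈ K, ‖x - proj K x‖ ≤ ‖x - z‖ :=
    Classical.epsilon_spec (p := fun y => y ∈ K ∧ ∀ z ∈ K, ‖x - y‖ ≤ ‖x - z‖) ⟨y, hy, hmin⟩
  have h1 := key _ hspec.1
  have h2 := pow_le_pow_left₀ (norm_nonneg _) (hspec.2 y hy) 2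
  have h3 : ‖proj K x - y‖ ^ 2 = 0 := le_antisymm (by linarith) (sq_nonneg _)
  rwa [sq_eq_zero_iff, norm_sub_eq_zero_iff] at h3

/-- To the right of the first edge and below the corner, the nearest point lies on that edge. -/
theorem proj_edge {θ : ℝ} (hθ : θ ∈ Ioo 0 Real.pi) {x : ℂ} (hre : 0 ≤ x.re) (him : x.im ≤ 0) :
    proj (angularDomain θ) x = ⟨0, x.im⟩ := by
  have hsin := Real.sin_pos_of_mem_Ioo hθ
  refine proj_eq_of_inner_nonpos ⟨le_rfl, ?_⟩ fun z hz => ?_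
  · simpa using mul_nonpos_of_nonpos_of_nonneg him hsin.le
  · have := mul_nonpos_of_nonpos_of_nonneg hz.1 hre
    simpa [Complex.inner] using by linarith

/-- `sin θ` times the inner product equals `z.re (x.re sin θ - x.im cos θ) + x.im (z.re cos θ + z.im
sin θ)`, and both summands are nonpositive. -/
theorem inner_nonpos_of_mem_sector {θ : ℝ} (hθ : θ ∈ Ioo 0 Real.pi) {x z : ℂ} (him : 0 ≤ x.im)
    (hx : 0 ≤ x.re * Real.sin θ - x.im * Real.cos θ) (hz : z ∈ angularDomain θ) :
    inner ℝ x z ≤ 0 := by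
  have hsin := Real.sin_pos_of_mem_Ioo hθ
  have h1 := mul_nonpos_of_nonpos_of_nonneg hz.1 hx
  have h2 := mul_nonpos_of_nonpos_of_nonneg hz.2 him
  rw [Complex.inner]
  simp only [Complex.mul_re, Complex.conj_re, Complex.conj_im]
  refine nonpos_of_mul_nonpos_left ?_ hsin
  nlinarith

/-- The sector between the two normals is projected to the corner. -/
theorem proj_sector {θ : ℝ} (hθ : θ ∈ Ioo 0 Real.pi) {x : ℂ} (him : 0 ≤ x.im)
    (hx : 0 ≤ x.re * Real.sin θ - x.im * Real.cos θ) : proj (angularDomain θ) x = 0 := by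
  refine proj_eq_of_inner_nonpos ⟨by simp, by simp⟩ fun z hz => ?_
  simpa using inner_nonpos_of_mem_sector hθ him hx hz

/-! ### The acceleration in the two regimes -/

namespace ProblemData

variable (p : ProblemData)

/-- The acceleration while the first edge is active. -/
noncomputable def edgeField (q : ℂ × ℂ) : ℂ :=
  ((-(2 * p.α * √p.k * q.2.re) - p.k * q.1.re : ℝ) : ℂ)

/-- The acceleration while the corner is active. -/
noncomputable def cornerField (q : ℂ × ℂ) : ℂ :=
  -((2 * p.α * √p.k) • (inner ℝ q.2 q.1 / ‖q.1‖ ^ 2) • q.1) - p.k • q.1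

variable {p}

theorem acceleration_edge (hθ : p.θbar ∈ Ioo 0 Real.pi) {u v : ℂ} (hre : 0 < u.re)
    (him : u.im ≤ 0) : p.acceleration u v = p.edgeField (u, v) := by
  have hu : u ∉ angularDomain p.θbar := fun h => absurd h.1 (not_le.2 hre)
  have hsub : u - ⟨0, u.im⟩ = (u.re : ℂ) := by apply Complex.ext <;> simp
  have hcoef : (inner ℝ v (u.re : ℂ) / ‖(u.re : ℂ)‖ ^ 2) • (u.re : ℂ) = (v.re : ℂ) := by
    have : inner ℝ v (u.re : ℂ) / ‖(u.re : ℂ)‖ ^ 2 * u.re = v.re := by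
      have hne := hre.ne'
      simp only [Complex.inner, Complex.mul_re, Complex.conj_re, Complex.conj_im,
        Complex.ofReal_re, Complex.ofReal_im, Complex.norm_real, Real.norm_eq_abs, sq_abs]
      field_simp
      ring
    rw [Complex.real_smul, ← Complex.ofReal_mul, this]
  rw [acceleration, damping, if_neg hu, proj_edge hθ hre.le him, hsub, hcoef, edgeField]
  simp only [Complex.real_smul]
  push_cast
  ring

theorem acceleration_corner (hθ : p.θbar ∈ Ioo 0 Real.pi) {u v : ℂ} (him : 0 < u.im)
    (hu : 0 ≤ u.re * Real.sin p.θbar - u.im * Real.cos p.θbar) :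
    p.acceleration u v = p.cornerField (u, v) := by
  have hK : u ∉ angularDomain p.θbar := by
    intro h
    have h1 := inner_nonpos_of_mem_sector hθ him.le hu h
    rw [real_inner_self_eq_norm_sq] at h1
    have h2 : 0 < ‖u‖ := norm_pos_iff.2 fun h0 => by simp [h0] at him
    nlinarith
  rw [acceleration, damping, if_neg hK, proj_sector hθ him.le hu, sub_zero, cornerField]

theorem contDiff_edgeField : ContDiff ℝ 1 p.edgeField := by
  unfold edgeField
  have h1 : ContDiff ℝ 1 fun q : ℂ × ℂ => q.2.re := Complex.reCLM.contDiff.comp contDiff_snd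
  have h2 : ContDiff ℝ 1 fun q : ℂ × ℂ => q.1.re := Complex.reCLM.contDiff.comp contDiff_fst
  exact Complex.ofRealCLM.contDiff.comp
    (((contDiff_const.mul h1).neg).sub (contDiff_const.mul h2))

theorem contDiffAt_cornerField {q : ℂ × ℂ} (hq : q.1 ≠ 0) : ContDiffAt ℝ 1 p.cornerField q := by
  unfold cornerField
  have h : ContDiffAt ℝ 1 (fun q : ℂ × ℂ => inner ℝ q.2 q.1 / ‖q.1‖ ^ 2) q :=
    (contDiffAt_snd.inner ℝ contDiffAt_fst).div (contDiffAt_fst.norm_sq ℝ)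
      (pow_ne_zero 2 (norm_ne_zero_iff.2 hq))
  exact ((h.smul contDiffAt_fst).const_smul _).neg.sub (contDiffAt_fst.const_smul _)

/-! ### Uniqueness by continuation from one-sided information -/

/-- Wherever the acceleration is given by a continuous field just after time `t`, the velocity is
right-differentiable at `t`. -/
theorem IsPenalizedMotionOn.hasDerivWithinAt_vel {T : ℝ} {u v : ℝ → ℂ}
    (h : p.IsPenalizedMotionOn T u v) {A : ℂ × ℂ → ℂ} {t : ℝ} (ht : t ∈ Ico 0 T)
    (hA : ContinuousAt A (u t, v t))
    (hacc : ∀ᶠ σ in 𝓝[>] t, p.acceleration (u σ) (v σ) = A (u σ, v σ)) :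
    HasDerivWithinAt v (A (u t, v t)) (Ici t) t := by
  have htT : t ∈ Icc 0 T := Ico_subset_Icc_self ht
  have h0T : (0 : ℝ) ≤ T := ht.1.trans ht.2.le
  have hsub : Icc t T ⊆ Icc 0 T := Icc_subset_Icc_left ht.1
  have hmem : Icc 0 T ∈ 𝓝[>] t :=
    mem_of_superset (Ioc_mem_nhdsGT ht.2) (Ioc_subset_Icc_self.trans hsub)
  have huc : Tendsto u (𝓝[>] t) (𝓝 (u t)) :=
    ((h.vel t htT).continuousWithinAt.mono_of_mem_nhdsWithin hmem)
  have hvc : Tendsto v (𝓝[>] t) (𝓝 (v t)) := (h.vel_cont t htT).mono_of_mem_nhdsWithin hmem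
  have hlim : Tendsto (fun σ => p.acceleration (u σ) (v σ)) (𝓝[>] t) (𝓝 (A (u t, v t))) :=
    (hA.tendsto.comp (huc.prodMk_nhds hvc)).congr' (hacc.mono fun _ hσ => hσ.symm)
  have hmeas : StronglyMeasurableAtFilter (fun σ => p.acceleration (u σ) (v σ)) (𝓝[>] t) :=
    ⟨Ioc t T, Ioc_mem_nhdsGT ht.2,
      (h.integrable T (right_mem_Icc.2 h0T)).1.aestronglyMeasurable.mono_set
        (Ioc_subset_Ioc_left ht.1)⟩
  -- The one-sided fundamental theorem of calculus needs only the right limit of the acceleration;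
  -- its value at `t`, where `G` may jump, is irrelevant.
  have hder := (intervalIntegral.integral_hasDerivWithinAt_of_tendsto_ae_right (s := Ici t)
    (t := Ioi t) (h.integrable t htT) hmeas (hlim.mono_left inf_le_left)).const_add (v 0)
  refine hder.congr_of_eventuallyEq ?_ (h.motion t htT)
  filter_upwards [Icc_mem_nhdsGE ht.2] with σ hσ using h.motion σ (hsub hσ)

/-- Uniqueness by continuation: a penalized motion follows a solution `w` of `w'' = A(w, w')` as
long as, right after any time up to which they agree, its acceleration is given by `A`. -/
theorem IsPenalizedMotionOn.eqOn_of_field {T : ℝ} {u v : ℝ → ℂ}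
    (h : p.IsPenalizedMotionOn T u v) {A : ℂ × ℂ → ℂ} {w w' : ℝ → ℂ} {a b : ℝ} (ha : 0 ≤ a)
    (hb : b ≤ T) (hA : ∀ t ∈ Ico a b, ContDiffAt ℝ 1 A (w t, w' t))
    (hw : ∀ t ∈ Icc a b, HasDerivWithinAt w (w' t) (Icc a b) t)
    (hw' : ∀ t ∈ Icc a b, HasDerivWithinAt w' (A (w t, w' t)) (Icc a b) t)
    (hacc : ∀ t ∈ Ico a b, u t = w t → v t = w' t →
      ∀ᶠ σ in 𝓝[>] t, p.acceleration (u σ) (v σ) = A (u σ, v σ))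
    (hu₀ : u a = w a) (hv₀ : v a = w' a) :
    ∀ t ∈ Icc a b, u t = w t ∧ v t = w' t := by
  have hsub : Icc a b ⊆ Icc 0 T := Icc_subset_Icc ha hb
  set f : ℝ → ℂ × ℂ := fun t => (u t, v t) with hf
  set g : ℝ → ℂ × ℂ := fun t => (w t, w' t) with hg
  have hfc : ContinuousOn f (Icc a b) := fun t ht =>
    ((h.vel t (hsub ht)).continuousWithinAt.prodMk (h.vel_cont t (hsub ht))).mono hsub
  have hgc : ContinuousOn g (Icc a b) := fun t ht =>
    (hw t ht).continuousWithinAt.prodMk (hw' t ht).continuousWithinAt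
  have hclosed : IsClosed ({t | f t = g t} ∩ Icc a b) := by
    have := (hfc.prodMk hgc).preimage_isClosed_of_isClosed isClosed_Icc
      (isClosed_diagonal (X := ℂ × ℂ))
    rw [inter_comm]
    exact this
  have hall : Icc a b ⊆ {t | f t = g t} := by
    -- Continuous induction: the agreement set is closed, so it suffices to extend agreement to the
    -- right of each of its points before `b`.
    refine hclosed.Icc_subset_of_forall_mem_nhdsWithin (by simp [hf, hg, hu₀, hv₀]) ?_
    rintro s ⟨hs, hsab⟩
    have hs : f s = g s := hs
    have hsI := Ico_subset_Icc_self hsab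
    obtain ⟨K, N, hN, hK⟩ := (hA s hsab).exists_lipschitzOnWith
    have hIcc : Icc a b ∈ 𝓝[≥] s :=
      mem_of_superset (Icc_mem_nhdsGE hsab.2) (Icc_subset_Icc_left hsab.1)
    have hfN : ∀ᶠ t in 𝓝[≥] s, f t ∈ interior N := by
      refine (hfc s hsI).mono_of_mem_nhdsWithin hIcc ?_
      rw [hs]
      exact interior_mem_nhds.2 hN
    have hgN : ∀ᶠ t in 𝓝[≥] s, g t ∈ interior N :=
      (hgc s hsI).mono_of_mem_nhdsWithin hIcc (interior_mem_nhds.2 hN)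
    have hev := hacc s hsab (congrArg Prod.fst hs) (congrArg Prod.snd hs)
    obtain ⟨e₁, he₁, h₁⟩ := mem_nhdsGE_iff_exists_Ico_subset.1 (hfN.and hgN)
    obtain ⟨e₂, he₂, h₂⟩ := mem_nhdsGT_iff_exists_Ioo_subset.1 hev
    set e := min (min e₁ e₂) b with he
    have hse : s < e := lt_min (lt_min he₁ he₂) hsab.2
    have hee₁ : e ≤ e₁ := (min_le_left _ _).trans (min_le_left _ _)
    have hee₂ : e ≤ e₂ := (min_le_left _ _).trans (min_le_right _ _)
    have heb : e ≤ b := min_le_right _ _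
    have hIe : Icc s e ⊆ Icc a b := Icc_subset_Icc hsab.1 heb
    have hNt : ∀ t ∈ Ico s e, f t ∈ interior N ∧ g t ∈ interior N := fun t ht =>
      h₁ ⟨ht.1, ht.2.trans_le hee₁⟩
    have hKA : LipschitzOnWith (max 1 K) (fun q : ℂ × ℂ => (q.2, A q)) N :=
      (LipschitzWith.prod_snd.lipschitzOnWith).prodMk hK
    -- On this short interval both curves stay where `A` is Lipschitz and both solve the same
    -- first-order system from the right, so Grönwall uniqueness applies.
    have heq : EqOn f g (Icc s e) := by
      refine ODE_solution_unique_of_mem_Icc_right (v := fun _ q => (q.2, A q)) (s := fun _ => N)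
        (fun _ _ => hKA) (hfc.mono hIe) ?_ (fun t ht => interior_subset (hNt t ht).1)
        (hgc.mono hIe) ?_ (fun t ht => interior_subset (hNt t ht).2) hs
      · intro t ht
        have htI := hIe (Ico_subset_Icc_self ht)
        have htT : t ∈ Ico 0 T := ⟨(hsub htI).1, ht.2.trans_le (heb.trans hb)⟩
        refine HasDerivWithinAt.prodMk ?_ (h.hasDerivWithinAt_vel htT ?_ ?_)
        · exact (h.vel t (hsub htI)).mono_of_mem_nhdsWithin
            (mem_of_superset (Icc_mem_nhdsGE htT.2) (Icc_subset_Icc_left htT.1))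
        · exact hK.continuousOn.continuousAt (mem_interior_iff_mem_nhds.1 (hNt t ht).1)
        · filter_upwards [Ioo_mem_nhdsGT ht.2] with σ hσ
          exact h₂ ⟨ht.1.trans_lt hσ.1, hσ.2.trans_le hee₂⟩
      · intro t ht
        have htI := hIe (Ico_subset_Icc_self ht)
        have hnhds : Icc a b ∈ 𝓝[≥] t := mem_of_superset
          (Icc_mem_nhdsGE (ht.2.trans_le heb)) (Icc_subset_Icc_left htI.1)
        exact ((hw t htI).mono_of_mem_nhdsWithin hnhds).prodMk
          ((hw' t htI).mono_of_mem_nhdsWithin hnhds)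
    exact mem_of_superset (Icc_mem_nhdsGT hse) heq
  exact fun t ht => ⟨congrArg Prod.fst (hall ht), congrArg Prod.snd (hall ht)⟩

end ProblemData

/-- Handles the two entry times, when the motion lies on the boundary of the region it is about to
enter and continuity alone does not decide. -/
theorem eventually_pos_of_hasDerivWithinAt {h : ℝ → ℝ} {d t T : ℝ} (htT : t < T)
    (hd : HasDerivWithinAt h d (Icc t T) t) (h0 : h t = 0) (hpos : 0 < d) :
    ∀ᶠ σ in 𝓝[>] t, 0 < h σ := by
  have hd' : HasDerivWithinAt h d (Ioi t) t := (hd.mono Ioc_subset_Icc_self).mono_of_mem_nhdsWithin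
    (Ioc_mem_nhdsGT htT)
  rw [hasDerivWithinAt_iff_tendsto_slope' (by simp)] at hd'
  filter_upwards [hd'.eventually (lt_mem_nhds hpos), self_mem_nhdsWithin] with σ hσ hlt
  rw [slope_def_field, h0, sub_zero] at hσ
  exact (div_pos_iff_of_pos_right (sub_pos.2 hlt)).1 hσ

namespace ProblemData

variable {p : ProblemData}

theorem IsPenalizedMotionOn.tendsto_pos {T : ℝ} {u v : ℝ → ℂ} (h : p.IsPenalizedMotionOn T u v)
    {t : ℝ} (ht : t ∈ Ico 0 T) : Tendsto u (𝓝[>] t) (𝓝 (u t)) :=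
  (h.vel t (Ico_subset_Icc_self ht)).continuousWithinAt.mono_of_mem_nhdsWithin
    (mem_of_superset (Ioc_mem_nhdsGT ht.2)
      (Ioc_subset_Icc_self.trans (Icc_subset_Icc_left ht.1)))

theorem IsPenalizedMotionOn.hasDerivWithinAt_re {T : ℝ} {u v : ℝ → ℂ}
    (h : p.IsPenalizedMotionOn T u v) {t : ℝ} (ht : t ∈ Icc 0 T) :
    HasDerivWithinAt (fun t => (u t).re) (v t).re (Icc t T) t := by
  exact (Complex.reCLM.hasFDerivAt.comp_hasDerivWithinAt t (h.vel t ht)).mono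
    (Icc_subset_Icc_left ht.1)

theorem IsPenalizedMotionOn.hasDerivWithinAt_im {T : ℝ} {u v : ℝ → ℂ}
    (h : p.IsPenalizedMotionOn T u v) {t : ℝ} (ht : t ∈ Icc 0 T) :
    HasDerivWithinAt (fun t => (u t).im) (v t).im (Icc t T) t := by
  exact (Complex.imCLM.hasFDerivAt.comp_hasDerivWithinAt t (h.vel t ht)).mono
    (Icc_subset_Icc_left ht.1)

/-! ### The explicit motion along the first edge -/

theorem Δ_pos (hα : 1 < p.α) : 0 < p.Δ := by unfold Δ; nlinarith

theorem sq_sqrt_Δ (hα : 1 < p.α) : √p.Δ ^ 2 = p.α ^ 2 - 1 := Real.sq_sqrt (Δ_pos hα).le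

theorem ξ₁_root (hα : 1 < p.α) : p.ξ₁ ^ 2 + 2 * p.α * p.ξ₁ + 1 = 0 := by
  unfold ξ₁; nlinarith [sq_sqrt_Δ hα]

theorem ξ₂_root (hα : 1 < p.α) : p.ξ₂ ^ 2 + 2 * p.α * p.ξ₂ + 1 = 0 := by
  unfold ξ₂; nlinarith [sq_sqrt_Δ hα]

theorem ξ₁_sub_ξ₂ : p.ξ₁ - p.ξ₂ = 2 * √p.Δ := by unfold ξ₁ ξ₂; ring

theorem ξ₁_ne_zero (hα : 1 < p.α) : p.ξ₁ ≠ 0 := fun h => by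
  have := ξ₁_root hα
  simp [h] at this

theorem t₀_pos (hx₂ : p.x₂0 < 0) (hv₂ : 0 < p.v₂) : 0 < p.t₀ :=
  div_pos (neg_pos.2 hx₂) hv₂

theorem η_pos : 0 < p.η := Real.exp_pos _

theorem ε_lt_one (hα : 1 < p.α) (hk : 0 < p.k) (hx₂ : p.x₂0 < 0) (hv₂ : 0 < p.v₂) : p.ε < 1 := by
  have h1 := Real.sqrt_pos.2 (Δ_pos hα)
  have h2 := Real.sqrt_pos.2 hk
  have h3 := t₀_pos hx₂ hv₂
  have h4 : p.ξ₂ - p.ξ₁ < 0 := by linarith [p.ξ₁_sub_ξ₂]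
  exact Real.exp_lt_one_iff.2 (mul_neg_of_neg_of_pos (mul_neg_of_neg_of_pos h4 h3) h2)

variable (p)

/-- The first coordinate of the motion while the first edge is active. -/
noncomputable def edgeCoord (t : ℝ) : ℝ :=
  p.v₁ / (2 * √p.Δ * √p.k) *
    (Real.exp (p.ξ₁ * √p.k * t) - Real.exp (p.ξ₂ * √p.k * t))

noncomputable def edgeSpeed (t : ℝ) : ℝ :=
  p.v₁ / (2 * √p.Δ) *
    (p.ξ₁ * Real.exp (p.ξ₁ * √p.k * t) - p.ξ₂ * Real.exp (p.ξ₂ * √p.k * t))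

/-- The motion while the first edge is active. -/
noncomputable def edgePos (t : ℝ) : ℂ :=
  (p.edgeCoord t : ℂ) + ((p.x₂0 + p.v₂ * t : ℝ) : ℂ) * Complex.I

noncomputable def edgeVel (t : ℝ) : ℂ := (p.edgeSpeed t : ℂ) + (p.v₂ : ℂ) * Complex.I

variable {p}

theorem hasDerivAt_exp_mul (a t : ℝ) :
    HasDerivAt (fun t => Real.exp (a * t)) (a * Real.exp (a * t)) t := by
  simpa [mul_comm] using ((hasDerivAt_id t).const_mul a).exp

theorem hasDerivAt_edgeCoord (hk : 0 < p.k) (t : ℝ) :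
    HasDerivAt p.edgeCoord (p.edgeSpeed t) t := by
  have hk' := (Real.sqrt_pos.2 hk).ne'
  refine (((hasDerivAt_exp_mul (p.ξ₁ * √p.k) t).sub
    (hasDerivAt_exp_mul (p.ξ₂ * √p.k) t)).const_mul _).congr_deriv ?_
  unfold edgeSpeed
  field_simp

theorem hasDerivAt_edgeSpeed (hα : 1 < p.α) (hk : 0 < p.k) (t : ℝ) :
    HasDerivAt p.edgeSpeed
      (-(2 * p.α * √p.k * p.edgeSpeed t) - p.k * p.edgeCoord t) t := by
  have hk' := (Real.sqrt_pos.2 hk).ne'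
  have hΔ := (Real.sqrt_pos.2 (Δ_pos hα)).ne'
  refine ((((hasDerivAt_exp_mul (p.ξ₁ * √p.k) t).const_mul p.ξ₁).sub
    ((hasDerivAt_exp_mul (p.ξ₂ * √p.k) t).const_mul p.ξ₂)).const_mul _).congr_deriv ?_
  have hkk : p.k = √p.k * √p.k := (Real.mul_self_sqrt hk.le).symm
  unfold edgeSpeed edgeCoord
  set X := Real.exp (p.ξ₁ * √p.k * t)
  set Y := Real.exp (p.ξ₂ * √p.k * t)
  set κ := √p.k
  rw [hkk]
  field_simp
  linear_combination p.v₁ * X * ξ₁_root hα - p.v₁ * Y * ξ₂_root hα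

theorem hasDerivAt_edgePos (hk : 0 < p.k) (t : ℝ) : HasDerivAt p.edgePos (p.edgeVel t) t := by
  have h : HasDerivAt (fun t => p.x₂0 + p.v₂ * t) p.v₂ t := by
    simpa using ((hasDerivAt_id t).const_mul p.v₂).const_add p.x₂0
  exact (hasDerivAt_edgeCoord hk t).ofReal_comp.add (h.ofReal_comp.mul_const _)

theorem hasDerivAt_edgeVel (hα : 1 < p.α) (hk : 0 < p.k) (t : ℝ) :
    HasDerivAt p.edgeVel (p.edgeField (p.edgePos t, p.edgeVel t)) t := by
  have := (hasDerivAt_edgeSpeed hα hk t).ofReal_comp.add_const ((p.v₂ : ℂ) * Complex.I)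
  refine this.congr_deriv ?_
  simp [edgeField, edgePos, edgeVel]

theorem edgeCoord_pos (hα : 1 < p.α) (hk : 0 < p.k) (hv₁ : 0 < p.v₁) {t : ℝ} (ht : 0 < t) :
    0 < p.edgeCoord t := by
  have hk' := Real.sqrt_pos.2 hk
  have hΔ := Real.sqrt_pos.2 (Δ_pos hα)
  refine mul_pos (by positivity) (sub_pos.2 (Real.exp_lt_exp.2 ?_))
  have : p.ξ₂ < p.ξ₁ := by linarith [p.ξ₁_sub_ξ₂]
  gcongr

/-- Until the time `t₀`, every penalized motion is the explicit damped oscillation. -/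
theorem IsPenalizedMotionOn.eq_edge {T : ℝ} {u v : ℝ → ℂ} (h : p.IsPenalizedMotionOn T u v)
    (hα : 1 < p.α) (hθ : p.θbar ∈ Ioo 0 Real.pi) (hk : 0 < p.k) (hv₁ : 0 < p.v₁)
    (hv₂ : 0 < p.v₂) (hT : p.t₀ ≤ T) {t : ℝ} (ht : t ∈ Icc 0 p.t₀) :
    u t = p.edgePos t ∧ v t = p.edgeVel t := by
  refine h.eqOn_of_field (A := p.edgeField) le_rfl hT (fun t _ => contDiff_edgeField.contDiffAt)
    (fun t _ => (hasDerivAt_edgePos hk t).hasDerivWithinAt)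
    (fun t _ => (hasDerivAt_edgeVel hα hk t).hasDerivWithinAt) ?_ ?_ ?_ t ht
  · intro t ht hut _
    have htT : t ∈ Ico 0 T := ⟨ht.1, ht.2.trans_le hT⟩
    have hlim := h.tendsto_pos htT
    have him : ∀ᶠ σ in 𝓝[>] t, (u σ).im < 0 := by
      refine (Complex.continuous_im.tendsto _ |>.comp hlim).eventually_lt_const ?_
      have h1 : (u t).im = p.x₂0 + p.v₂ * t := by simp [hut, edgePos]
      have h2 := ht.2
      rw [t₀, lt_div_iff₀ hv₂] at h2
      linarith
    have hre : ∀ᶠ σ in 𝓝[>] t, 0 < (u σ).re := by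
      rcases ht.1.eq_or_lt with h0 | h0
      -- At time `0` the first coordinate vanishes; the velocity `v₁ > 0` carries the motion out of
      -- `K`.
      · subst h0
        refine eventually_pos_of_hasDerivWithinAt htT.2
          (h.hasDerivWithinAt_re (Ico_subset_Icc_self htT)) ?_ ?_
        · simp [h.init_pos]
        · simpa [h.init_vel] using hv₁
      · refine (Complex.continuous_re.tendsto _ |>.comp hlim).eventually_const_lt ?_
        simpa [hut, edgePos] using edgeCoord_pos hα hk hv₁ h0
    filter_upwards [him, hre] with σ h1 h2 using acceleration_edge hθ h2 h1.le
  · rw [h.init_pos]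
    apply Complex.ext <;> simp [edgePos, edgeCoord]
  · have hΔ := (Real.sqrt_pos.2 (Δ_pos hα)).ne'
    have hs : p.edgeSpeed 0 = p.v₁ := by
      simp only [edgeSpeed, mul_zero, Real.exp_zero, mul_one, ξ₁_sub_ξ₂]
      field_simp
    rw [h.init_vel]
    apply Complex.ext <;> simp [edgeVel, hs]

variable (p)

/-- The conserved value of `R² Θ'`. -/
noncomputable def momentum : ℝ := √p.E * (1 - p.ε)

variable {p}

/-- The positive velocities select the root; this form turns the scaled angular momentum into the
vertical speed `v₂` at `t₀`. -/
theorem sqrt_E (hα : 1 < p.α) (hv₁ : 0 < p.v₁) (hv₂ : 0 < p.v₂) :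
    √p.E = p.v₁ * p.v₂ / (2 * √p.Δ) := by
  have hΔ := Δ_pos hα
  rw [E, show p.v₁ ^ 2 * p.v₂ ^ 2 / (4 * p.Δ) = (p.v₁ * p.v₂ / (2 * √p.Δ)) ^ 2 by
    rw [div_pow, mul_pow, mul_pow, Real.sq_sqrt hΔ.le]; norm_num]
  exact Real.sqrt_sq (by positivity)

theorem momentum_pos (hα : 1 < p.α) (hk : 0 < p.k) (hx₂ : p.x₂0 < 0) (hv₁ : 0 < p.v₁)
    (hv₂ : 0 < p.v₂) : 0 < p.momentum := by
  have hΔ := Real.sqrt_pos.2 (Δ_pos hα)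
  have hε := sub_pos.2 (ε_lt_one hα hk hx₂ hv₂)
  rw [momentum, sqrt_E hα hv₁ hv₂]
  positivity

theorem momentum_sq (hα : 1 < p.α) : p.momentum ^ 2 = p.E * (1 - p.ε) ^ 2 := by
  have hΔ := Δ_pos hα
  have hE : 0 ≤ p.E := by unfold E; positivity
  rw [momentum, mul_pow, Real.sq_sqrt hE]

end ProblemData

/-! ### Polar motion and its rescaling -/

/-- The curve with polar coordinates `R`, `Θ`. -/
noncomputable def polarPos (R Θ : ℝ → ℝ) (τ : ℝ) : ℂ :=
  (R τ : ℂ) * Complex.exp (Complex.I * (Θ τ : ℂ))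

/-- The velocity of `polarPos R Θ` when `R' = V` and `R² Θ' = c`. -/
noncomputable def polarVel (c : ℝ) (R V Θ : ℝ → ℝ) (τ : ℝ) : ℂ :=
  ((V τ : ℂ) + Complex.I * ((c / R τ : ℝ) : ℂ)) * Complex.exp (Complex.I * (Θ τ : ℂ))

section

variable {c A : ℝ} {R V Θ : ℝ → ℝ} {s : Set ℝ} {τ : ℝ}

theorem hasDerivWithinAt_polarPos (hR₀ : R τ ≠ 0) (hR : HasDerivWithinAt R (V τ) s τ)
    (hΘ : HasDerivWithinAt Θ (c / R τ ^ 2) s τ) :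
    HasDerivWithinAt (polarPos R Θ) (polarVel c R V Θ τ) s τ := by
  have hR' : (R τ : ℂ) ≠ 0 := by exact_mod_cast hR₀
  refine (hR.ofReal_comp.mul (hΘ.ofReal_comp.const_mul Complex.I).cexp).congr_deriv ?_
  unfold polarVel
  push_cast
  field_simp

/-- The centrifugal term `c² / R³` cancels and constancy of `c` removes the tangential part, leaving
the radial force `-A`. -/
theorem hasDerivWithinAt_polarVel (hR₀ : R τ ≠ 0) (hR : HasDerivWithinAt R (V τ) s τ)
    (hV : HasDerivWithinAt V (c ^ 2 / R τ ^ 3 - A) s τ)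
    (hΘ : HasDerivWithinAt Θ (c / R τ ^ 2) s τ) :
    HasDerivWithinAt (polarVel c R V Θ)
      (-(A : ℂ) * Complex.exp (Complex.I * (Θ τ : ℂ))) s τ := by
  have hR' : (R τ : ℂ) ≠ 0 := by exact_mod_cast hR₀
  have hdiv := (hasDerivWithinAt_const τ s c).div hR hR₀
  refine ((hV.ofReal_comp.add (hdiv.ofReal_comp.const_mul Complex.I)).mul
    (hΘ.ofReal_comp.const_mul Complex.I).cexp).congr_deriv ?_
  simp only [Pi.add_apply, Pi.div_apply]
  push_cast
  field_simp
  linear_combination (c : ℂ) ^ 2 * Complex.I_sq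

end

namespace ProblemData

variable {p : ProblemData}

/-- Damping sees only the radial velocity `a`; the tangential velocity `b` is orthogonal to the
position and drops out. -/
theorem cornerField_polar (hk : 0 < p.k) {r a b φ ρ : ℝ} (hr : 0 < r) (hρ : 0 < ρ) :
    p.cornerField (((ρ / √p.k : ℝ) : ℂ) * ((r : ℂ) * Complex.exp (Complex.I * φ)),
        (ρ : ℂ) * (((a : ℂ) + Complex.I * (b : ℂ)) * Complex.exp (Complex.I * φ))) =
      ((ρ * √p.k : ℝ) : ℂ) *
        (-((2 * p.α * a + r : ℝ) : ℂ) * Complex.exp (Complex.I * φ)) := by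
  have hk' := Real.sqrt_pos.2 hk
  have hkk : √p.k * √p.k = p.k := Real.mul_self_sqrt hk.le
  have hexp : ‖Complex.exp (Complex.I * φ)‖ = 1 := by
    rw [mul_comm]; exact Complex.norm_exp_ofReal_mul_I φ
  set e := Complex.exp (Complex.I * φ) with he
  have hee : e.re * e.re + e.im * e.im = 1 := by
    rw [← Complex.normSq_apply, Complex.normSq_eq_norm_sq, hexp, one_pow]
  have hnorm : ‖((ρ / √p.k : ℝ) : ℂ) * ((r : ℂ) * e)‖ ^ 2 = ρ ^ 2 / √p.k ^ 2 * r ^ 2 := by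
    simp only [norm_mul, hexp, Complex.norm_real, Real.norm_eq_abs, mul_one, mul_pow, sq_abs,
      div_pow]
  have hinner : inner ℝ ((ρ : ℂ) * (((a : ℂ) + Complex.I * (b : ℂ)) * e))
      (((ρ / √p.k : ℝ) : ℂ) * ((r : ℂ) * e)) = ρ ^ 2 / √p.k * (r * a) := by
    simp only [Complex.inner, Complex.mul_re, Complex.mul_im, Complex.conj_re, Complex.conj_im,
      Complex.ofReal_re, Complex.ofReal_im, Complex.add_re, Complex.add_im, Complex.I_re,
      Complex.I_im]
    linear_combination (ρ ^ 2 / √p.k * (r * a)) * hee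
  have hcoef : ρ ^ 2 / √p.k * (r * a) / (ρ ^ 2 / √p.k ^ 2 * r ^ 2) = √p.k * a / r := by
    field_simp
  simp only [cornerField, hnorm, hinner, hcoef, Complex.real_smul]
  have hrC : (r : ℂ) ≠ 0 := by exact_mod_cast hr.ne'
  have hkC : ((√p.k : ℝ) : ℂ) ≠ 0 := by exact_mod_cast hk'.ne'
  have hkkC : ((p.k : ℝ) : ℂ) = (√p.k : ℂ) * (√p.k : ℂ) := by exact_mod_cast hkk.symm
  push_cast
  rw [hkkC]
  field_simp
  ring

variable {R V Θ : ℝ → ℝ}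

theorem IsScaledMotion.hasDerivWithinAt_V (h : p.IsScaledMotion R V Θ) (hα : 1 < p.α) {τ : ℝ}
    (hτ : τ ∈ Ici (0 : ℝ)) : HasDerivWithinAt V
      (p.momentum ^ 2 / R τ ^ 3 - 2 * p.α * V τ - R τ) (Ici 0) τ := by
  rw [momentum_sq hα]
  exact h.deriv_V τ hτ

theorem exists_isScaledMotion (hα : 1 < p.α) (hk : 0 < p.k) (hx₂ : p.x₂0 < 0) (hv₁ : 0 < p.v₁)
    (hv₂ : 0 < p.v₂) : ∃ R V Θ : ℝ → ℝ, p.IsScaledMotion R V Θ := by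
  have hΔ := Real.sqrt_pos.2 (Δ_pos hα)
  have hε := sub_pos.2 (ε_lt_one hα hk hx₂ hv₂)
  have hη := p.η_pos
  obtain ⟨R, V, Θ, hR0, hV0, hΘ0, h⟩ := exists_polar_solution
    (V₀ := p.η * p.v₁ * p.ξ₁ * (1 - p.ε * p.ξ₂ / p.ξ₁) / (2 * √p.Δ)) (zero_le_one.trans hα.le)
    (momentum_pos hα hk hx₂ hv₁ hv₂)
    (show 0 < p.η * p.v₁ * (1 - p.ε) / (2 * √p.Δ) by positivity)
  refine ⟨R, V, Θ, fun τ hτ => (h τ hτ).1, hR0, hV0, hΘ0, fun τ hτ => (h τ hτ).2.1,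
    fun τ hτ => ?_, fun τ hτ => (h τ hτ).2.2.2⟩
  rw [← momentum_sq hα]
  exact (h τ hτ).2.2.1

theorem IsScaledMotion.angle_growth (h : p.IsScaledMotion R V Θ) (hα : 1 < p.α) (hk : 0 < p.k)
    (hx₂ : p.x₂0 < 0) (hv₁ : 0 < p.v₁) (hv₂ : 0 < p.v₂) :
    StrictMonoOn Θ (Ici 0) ∧ ∃ d > 0, ∀ τ ∈ Ici (0 : ℝ), Θ 0 + d * τ ≤ Θ τ :=
  polar_angle_growth (zero_le_one.trans hα.le) (momentum_pos hα hk hx₂ hv₁ hv₂) h.pos h.deriv_R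
    (fun _ hτ => h.hasDerivWithinAt_V hα hτ) h.deriv_Θ

theorem IsScaledMotion.exists_angle_eq (h : p.IsScaledMotion R V Θ) (hα : 1 < p.α) (hk : 0 < p.k)
    (hx₂ : p.x₂0 < 0) (hv₁ : 0 < p.v₁) (hv₂ : 0 < p.v₂) {θ : ℝ} (hθ : 0 < θ) :
    ∃ τ ∈ Ioi (0 : ℝ), Θ τ = θ := by
  obtain ⟨-, d, hd, hgrow⟩ := h.angle_growth hα hk hx₂ hv₁ hv₂
  have hpos : (0 : ℝ) ≤ θ / d := by positivity
  have hΘc : ContinuousOn Θ (Icc 0 (θ / d)) := fun τ hτ =>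
    (h.deriv_Θ τ hτ.1).continuousWithinAt.mono Icc_subset_Ici_self
  have hend : θ ≤ Θ (θ / d) := by
    have := hgrow (θ / d) hpos
    rwa [h.init_Θ, zero_add, mul_div_cancel₀ _ hd.ne'] at this
  obtain ⟨τ, hτ, hτθ⟩ := intermediate_value_Icc hpos hΘc ⟨by rw [h.init_Θ]; exact hθ.le, hend⟩
  refine ⟨τ, lt_of_le_of_ne hτ.1 fun h0 => ?_, hτθ⟩
  rw [← h0, h.init_Θ] at hτθ
  exact hθ.ne hτθ

variable (p) in
/-- The scaled time corresponding to `t`. -/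
noncomputable def scaledTime (t : ℝ) : ℝ := √p.k * (t - p.t₀)

variable (p) in
/-- The motion in the original variables with scaled polar coordinates `R`, `Θ`. -/
noncomputable def cornerPos (R Θ : ℝ → ℝ) (t : ℝ) : ℂ :=
  ((p.η / √p.k : ℝ) : ℂ) * polarPos R Θ (p.scaledTime t)

variable (p) in
noncomputable def cornerVel (R V Θ : ℝ → ℝ) (t : ℝ) : ℂ :=
  (p.η : ℂ) * polarVel p.momentum R V Θ (p.scaledTime t)

theorem scaledTime_mem {t : ℝ} (ht : p.t₀ ≤ t) : p.scaledTime t ∈ Ici (0 : ℝ) :=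
  mul_nonneg (Real.sqrt_nonneg _) (sub_nonneg.2 ht)

theorem hasDerivAt_scaledTime (t : ℝ) : HasDerivAt p.scaledTime √p.k t := by
  unfold scaledTime
  simpa using ((hasDerivAt_id t).sub_const p.t₀).const_mul √p.k

theorem hasDerivWithinAt_comp_scaledTime {g : ℝ → ℂ} {g' : ℂ} {t b : ℝ}
    (hg : HasDerivWithinAt g g' (Ici 0) (p.scaledTime t)) :
    HasDerivWithinAt (fun t => g (p.scaledTime t)) ((√p.k : ℂ) * g') (Icc p.t₀ b) t := by
  have := hg.scomp t (p.hasDerivAt_scaledTime t).hasDerivWithinAt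
    (fun s (hs : s ∈ Icc p.t₀ b) => scaledTime_mem hs.1)
  rwa [Complex.real_smul] at this

theorem IsScaledMotion.hasDerivWithinAt_cornerPos (h : p.IsScaledMotion R V Θ) (hk : 0 < p.k)
    {t b : ℝ} (ht : t ∈ Icc p.t₀ b) :
    HasDerivWithinAt (p.cornerPos R Θ) (p.cornerVel R V Θ t) (Icc p.t₀ b) t := by
  have hτ := p.scaledTime_mem ht.1
  have hkC : ((√p.k : ℝ) : ℂ) ≠ 0 := by exact_mod_cast (Real.sqrt_pos.2 hk).ne'
  refine ((hasDerivWithinAt_comp_scaledTime (hasDerivWithinAt_polarPos (h.pos _ hτ).ne'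
    (h.deriv_R _ hτ) (h.deriv_Θ _ hτ))).const_mul _).congr_deriv ?_
  unfold cornerVel momentum
  push_cast
  field_simp

theorem IsScaledMotion.hasDerivWithinAt_cornerVel (h : p.IsScaledMotion R V Θ) (hα : 1 < p.α)
    (hk : 0 < p.k) {t b : ℝ} (ht : t ∈ Icc p.t₀ b) :
    HasDerivWithinAt (p.cornerVel R V Θ)
      (p.cornerField (p.cornerPos R Θ t, p.cornerVel R V Θ t)) (Icc p.t₀ b) t := by
  have hτ := p.scaledTime_mem ht.1
  have hV := h.hasDerivWithinAt_V hα hτ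
  rw [sub_sub] at hV
  refine ((hasDerivWithinAt_comp_scaledTime (hasDerivWithinAt_polarVel (h.pos _ hτ).ne'
    (h.deriv_R _ hτ) hV (h.deriv_Θ _ hτ))).const_mul _).congr_deriv ?_
  rw [cornerPos, cornerVel, polarPos, polarVel, cornerField_polar hk (h.pos _ hτ) p.η_pos]
  push_cast
  ring

/-- The factor `1 / 2` in the exponent of `η` makes the slow exponential at `t₀` equal to `η²`: one
factor `η` goes into the length scale, the other into the initial data of `R`. -/
theorem exp_ξ₁ : Real.exp (p.ξ₁ * √p.k * p.t₀) = p.η ^ 2 := by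
  rw [η, ← Real.exp_nat_mul]
  congr 1
  push_cast
  ring

theorem exp_ξ₂ : Real.exp (p.ξ₂ * √p.k * p.t₀) = p.η ^ 2 * p.ε := by
  rw [← exp_ξ₁, ε, ← Real.exp_add]
  congr 1
  ring

theorem scaledTime_t₀ : p.scaledTime p.t₀ = 0 := by simp [scaledTime]

theorem IsScaledMotion.cornerPos_t₀ (h : p.IsScaledMotion R V Θ) (hv₂ : 0 < p.v₂) :
    p.cornerPos R Θ p.t₀ = p.edgePos p.t₀ := by
  have him : p.x₂0 + p.v₂ * p.t₀ = 0 := by unfold t₀; field_simp; ring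
  rw [cornerPos, polarPos, edgePos, edgeCoord, scaledTime_t₀, h.init_Θ, h.init_R, him, exp_ξ₁,
    exp_ξ₂]
  simp only [Complex.ofReal_zero, mul_zero, Complex.exp_zero, zero_mul, mul_one, add_zero]
  rw [← Complex.ofReal_mul]
  congr 1
  ring

/-- At angle zero the radial and tangential directions are the coordinate axes, so `η V(0)` must be
the edge speed and `η c / R(0)` must be `v₂`. -/
theorem IsScaledMotion.cornerVel_t₀ (h : p.IsScaledMotion R V Θ) (hα : 1 < p.α) (hk : 0 < p.k)
    (hx₂ : p.x₂0 < 0) (hv₁ : 0 < p.v₁) (hv₂ : 0 < p.v₂) :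
    p.cornerVel R V Θ p.t₀ = p.edgeVel p.t₀ := by
  have hΔ := Real.sqrt_pos.2 (Δ_pos hα)
  have hε := sub_pos.2 (ε_lt_one hα hk hx₂ hv₂)
  have hη := p.η_pos
  have hξ := ξ₁_ne_zero hα
  have hre : p.η * V 0 = p.edgeSpeed p.t₀ := by
    rw [h.init_V, edgeSpeed, exp_ξ₁, exp_ξ₂]
    field_simp
  have him : p.η * (p.momentum / R 0) = p.v₂ := by
    rw [h.init_R, momentum, sqrt_E hα hv₁ hv₂]
    have := hε.ne'
    field_simp
  rw [cornerVel, polarVel, edgeVel, scaledTime_t₀, h.init_Θ, ← hre, ← him]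
  simp only [Complex.ofReal_zero, mul_zero, Complex.exp_zero, mul_one]
  push_cast
  ring

theorem cornerPos_re (t : ℝ) : (p.cornerPos R Θ t).re =
    p.η / √p.k * R (p.scaledTime t) * Real.cos (Θ (p.scaledTime t)) := by
  rw [cornerPos, polarPos, mul_comm Complex.I, Complex.re_ofReal_mul, Complex.re_ofReal_mul,
    Complex.exp_ofReal_mul_I_re, mul_assoc]

theorem cornerPos_im (t : ℝ) : (p.cornerPos R Θ t).im =
    p.η / √p.k * R (p.scaledTime t) * Real.sin (Θ (p.scaledTime t)) := by
  rw [cornerPos, polarPos, mul_comm Complex.I, Complex.im_ofReal_mul, Complex.im_ofReal_mul,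
    Complex.exp_ofReal_mul_I_im, mul_assoc]

/-- After the time `t₀`, every penalized motion follows the polar motion as long as the polar angle
has not exceeded `θbar`. -/
theorem IsPenalizedMotionOn.eq_corner {T : ℝ} {u v : ℝ → ℂ} (hu : p.IsPenalizedMotionOn T u v)
    (h : p.IsScaledMotion R V Θ) (hα : 1 < p.α) (hθ : p.θbar ∈ Ioo 0 Real.pi) (hk : 0 < p.k)
    (hx₂ : p.x₂0 < 0) (hv₁ : 0 < p.v₁) (hv₂ : 0 < p.v₂) {t : ℝ} (ht₀ : p.t₀ ≤ t) (htT : t ≤ T)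
    (hangle : Θ (p.scaledTime t) ≤ p.θbar) : u t = p.cornerPos R Θ t := by
  have hk' := Real.sqrt_pos.2 hk
  have hη := p.η_pos
  have ht₀pos := t₀_pos hx₂ hv₂
  have hmono := (h.angle_growth hα hk hx₂ hv₁ hv₂).1
  have hstart := hu.eq_edge hα hθ hk hv₁ hv₂ (ht₀.trans htT) (right_mem_Icc.2 ht₀pos.le)
  have hr : ∀ s, p.t₀ ≤ s → 0 < p.η / √p.k * R (p.scaledTime s) := fun s hs =>
    mul_pos (by positivity) (h.pos _ (scaledTime_mem hs))
  refine (hu.eqOn_of_field (A := p.cornerField) ht₀pos.le htT ?_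
    (fun s hs => h.hasDerivWithinAt_cornerPos hk hs)
    (fun s hs => h.hasDerivWithinAt_cornerVel hα hk hs) ?_
    (hstart.1.trans (h.cornerPos_t₀ hv₂).symm)
    (hstart.2.trans (h.cornerVel_t₀ hα hk hx₂ hv₁ hv₂).symm) t (right_mem_Icc.2 ht₀)).1
  · intro s hs
    refine contDiffAt_cornerField ?_
    have hR := h.pos _ (p.scaledTime_mem hs.1)
    simp only [cornerPos, polarPos]
    refine mul_ne_zero ?_ (mul_ne_zero ?_ (Complex.exp_ne_zero _))
    · exact_mod_cast (div_pos hη hk').ne'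
    · exact_mod_cast hR.ne'
  · intro s hs hus hvs
    have hsT : s ∈ Ico 0 T := ⟨ht₀pos.le.trans hs.1, hs.2.trans_le htT⟩
    have hlim := hu.tendsto_pos hsT
    have hτ := p.scaledTime_mem hs.1
    -- Strict monotonicity of `Θ` makes the bound strict before the final time, so the motion is
    -- still strictly below the second normal.
    have hlt : Θ (p.scaledTime s) < p.θbar := by
      refine (hmono hτ (scaledTime_mem ht₀) ?_).trans_le hangle
      exact mul_lt_mul_of_pos_left (sub_lt_sub_right hs.2 _) hk'
    have hge : 0 ≤ Θ (p.scaledTime s) := by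
      rw [← h.init_Θ]
      exact hmono.monotoneOn self_mem_Ici hτ hτ
    have him : ∀ᶠ σ in 𝓝[>] s, 0 < (u σ).im := by
      rcases hs.1.eq_or_lt with h0 | h0
      · subst h0
        refine eventually_pos_of_hasDerivWithinAt hsT.2
          (hu.hasDerivWithinAt_im (Ico_subset_Icc_self hsT)) ?_ ?_
        · rw [hus, cornerPos_im, scaledTime_t₀, h.init_Θ, Real.sin_zero, mul_zero]
        · simpa [hstart.2, edgeVel] using hv₂
      · refine (Complex.continuous_im.tendsto _ |>.comp hlim).eventually_const_lt ?_
        have hpos : 0 < Θ (p.scaledTime s) := by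
          rw [← h.init_Θ]
          exact hmono self_mem_Ici hτ (mul_pos hk' (sub_pos.2 h0))
        rw [hus, cornerPos_im]
        exact mul_pos (hr s hs.1) (Real.sin_pos_of_pos_of_lt_pi hpos (hlt.trans hθ.2))
    have hside : ∀ᶠ σ in 𝓝[>] s,
        0 < (u σ).re * Real.sin p.θbar - (u σ).im * Real.cos p.θbar := by
      have hcont : Continuous fun z : ℂ => z.re * Real.sin p.θbar - z.im * Real.cos p.θbar := by
        fun_prop
      refine (hcont.tendsto _ |>.comp hlim).eventually_const_lt ?_
      -- In polar form the side condition is the radius times `sin (θbar - Θ)`.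
      have hsin : 0 < Real.sin (p.θbar - Θ (p.scaledTime s)) :=
        Real.sin_pos_of_pos_of_lt_pi (sub_pos.2 hlt) (by linarith [hθ.2])
      have hprod := mul_pos (hr s hs.1) hsin
      rw [Real.sin_sub] at hprod
      rw [hus, cornerPos_im, cornerPos_re]
      linarith
    filter_upwards [him, hside] with σ h1 h2 using acceleration_corner hθ h1 h2.le

end ProblemData

end PenaltyCorner

/-- The scaled motion exists for all times; its polar angle `Θ` takes the value `θbar` at some
time `τbar > 0`; and up to that time `(R, Θ)` are the scaled polar coordinates of every solution `u`
of the penalized problem, as long as `u` is defined. -/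
theorem mainTheorem10 (p : PenaltyCorner.ProblemData)
    (hα : 1 < p.α) (hθ : p.θbar ∈ Set.Ioo 0 Real.pi) (hk : 0 < p.k)
    (hx₂ : p.x₂0 < 0) (hv₁ : 0 < p.v₁) (hv₂ : 0 < p.v₂) :
    (∃ R V Θ : ℝ → ℝ, p.IsScaledMotion R V Θ) ∧
    ∀ R V Θ : ℝ → ℝ, p.IsScaledMotion R V Θ →
      ∃ τbar ∈ Set.Ioi (0 : ℝ), Θ τbar = p.θbar ∧
        ∀ (T : ℝ) (u v : ℝ → ℂ), p.IsPenalizedMotionOn T u v →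
          ∀ τ ∈ Set.Icc 0 τbar, p.t₀ + τ / √p.k ≤ T →
            u (p.t₀ + τ / √p.k) =
              ((p.η * R τ / √p.k : ℝ) : ℂ) * Complex.exp (Complex.I * (Θ τ : ℂ)) := by
  refine ⟨PenaltyCorner.ProblemData.exists_isScaledMotion hα hk hx₂ hv₁ hv₂, fun R V Θ h => ?_⟩
  obtain ⟨τbar, hτbar, hΘ⟩ := h.exists_angle_eq hα hk hx₂ hv₁ hv₂ hθ.1
  refine ⟨τbar, hτbar, hΘ, fun T u v hu τ hτ hT => ?_⟩
  have hk' := Real.sqrt_pos.2 hk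
  have htime : p.scaledTime (p.t₀ + τ / √p.k) = τ := by
    unfold PenaltyCorner.ProblemData.scaledTime
    field_simp
    ring
  have hangle : Θ (p.scaledTime (p.t₀ + τ / √p.k)) ≤ p.θbar := by
    rw [htime, ← hΘ]
    exact (h.angle_growth hα hk hx₂ hv₁ hv₂).1.monotoneOn hτ.1 (Ioi_subset_Ici_self hτbar) hτ.2
  rw [hu.eq_corner h hα hθ hk hx₂ hv₁ hv₂ (le_add_of_nonneg_right (div_nonneg hτ.1 hk'.le)) hT
    hangle, PenaltyCorner.ProblemData.cornerPos, PenaltyCorner.polarPos, htime]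
  push_cast
  ring
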